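/- Let $\mathcal X=(\mathbb C\times\mathbb H)/\mathbb Z^2\to\mathbb H$, with $(n,m)\cdot(z,s)=(z+n+ms,s)$, be the universal family of marked elliptic curves, with fibers $X_s=\mathbb C/(\mathbb Z+s\mathbb Z)$. Let $\mathcal K\to\mathbb H$ be the fibration of complexified Kähler classes, i.e. classes in $H^{1,1}(X_s,\mathbb C)$ whose imaginary part is a Kähler class; it is identified with $\mathbb H\times\mathbb H$ by letting $(\alpha,s)$ stand for the class of $\frac{\alpha}{\operatorname{Im}s}\,\frac i2\,dz\wedge d\bar z$ on $X_s$ (the class whose integral over $X_s$ is $\alpha$). The fiber product $\mathcal X\times_{\mathbb H}\mathcal K$ is the complex manifold $(\mathbb C\times\mathbb H\times\mathbb H)/\mathbb Z^2$, where $(n,m)\cdot(z,\alpha,s)=(z+n+ms,\alpha,s)$; let $q$ be the quotient map. The projections $(z,\alpha,s)\mapsto s$ and $(z,\alpha,s)\mapsto\alpha$ induce holomorphic fibrations $\nu:\mathcal X\times_{\mathbb H}\mathcal K\to\mathbb H$ and $\eta:\mathcal X\times_{\mathbb H}\mathcal K\to\mathcal K_0\cong\mathbb H$. For $(\alpha,s)\in\mathbb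 H\times\mathbb H$ let $g=u\,|dz|^2$, with Kähler form $u\,\frac i2dz\wedge d\bar z$, be the Ricci-flat Kähler metric on $X_s$ in the class $\operatorname{Im}\alpha$. It induces the pointwise norms $|\partial_z|^2=u$, $|dz|^2=|d\bar z|^2=1/u$, $|dz\wedge d\bar z|^2=1/u^2$. Let $f\,\frac i2dz\wedge d\bar z$ be the $g$-harmonic form on $X_s$ with integral $1$, representing $\partial_\alpha$. Let $\partial_s+b\,\partial_z$ be the canonical lift of $\partial_s$: the $\mathbb Z^2$-invariant smooth lift (that is, $b(z+n+ms)=b(z)+m$) along $X_s$ such that $\bar\partial(b\,\partial_z)=\frac{\partial b}{\partial\bar z}\,d\bar z\otimes\partial_z$ is $g$-harmonic, normalized to be tangent to the zero section, $b(0)=0$. The natural hermitian metric $\omega$ on $\mathcal X\times_{\mathbb H}\mathcal K$ is given by $$(q^*\omega)_{(z,\alpha,s)}(v,w)=u(z)\,(v_z-b(z)v_s)\overline{(w_z-b(z)w_s)}+\Big\|f\,\tfrac i2dz\wedge d\bar z\Big\|_{L^2(X_s,g)}^2v_\alpha\overline{w_\alpha}+\Big\|\tfrac{\partial b}{\partial\bar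 z}\,d\bar z\otimes\partial_z\Big\|_{L^2(X_s,g)}^2v_s\overline{w_s}.$$ **Theorem.** There is exactly one smooth hermitian metric $\omega$ on $\mathcal X\times_{\mathbb H}\mathcal K$ of this form (in particular, $u,f,b$ exist). The normalized hermitian metric $$\omega_U=\frac{1}{\operatorname{Vol}(X_s,\alpha)}\,\omega,\qquad \operatorname{Vol}(X_s,\alpha)=\operatorname{Im}\alpha,$$ becomes Kähler when restricted to any fiber of either $\nu$ or $\eta$. -/

import Mathlib

open scoped Manifold ContDiff UpperHalfPlane ComplexConjugate Topology

noncomputable section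

/-! ### Hermitian metrics on complex manifolds, and their restriction to fibres of a map -/

/-- The fundamental form `-Im B` of a hermitian form `B`, a real alternating 2-form: for
`B = ∑ h_{jk} dz_j ⊗ dz̄_k` it is `(i/2) ∑ h_{jk} dz_j ∧ dz̄_k`. -/
def fundamentalForm {E : Type*} [NormedAddCommGroup E] [NormedSpace ℂ E] [NormedSpace ℝ E]
    [IsScalarTower ℝ ℂ E] (B : E →L[ℂ] E →L⋆[ℂ] ℂ) (hB : ∀ v w, B w v = conj (B v w)) :
    E [⋀^Fin 2]→L[ℝ] ℝ where
  toFun v := -(B (v 0) (v 1)).im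
  map_update_add' := by
    intro _ m i a b
    fin_cases i <;> simp [Function.update] <;> ring
  map_update_smul' := by
    intro _ m i c a
    have hc : ∀ v : E, c • v = (c : ℂ) • v := fun v => (algebraMap_smul ℂ c v).symm
    fin_cases i
    · simp [Function.update, hc]
    · have h0 (x : E) : Function.update m 1 x 0 = m 0 := by simp [Function.update]
      have h1 (x : E) : Function.update m 1 x 1 = x := by simp [Function.update]
      change -(B (Function.update m 1 (c • a) 0) (Function.update m 1 (c • a) 1)).im =
        c • -(B (Function.update m 1 a 0) (Function.update m 1 a 1)).im
      rw [h0, h0, h1, h1, hc, map_smulₛₗ]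
      simp
  cont := by
    have h : Continuous fun v : Fin 2 → E => B (v 0) (v 1) :=
      (B.flip.continuous.comp (continuous_apply 1)).clm_apply (continuous_apply 0)
    exact (Complex.continuous_im.comp h).neg
  map_eq_zero_of_eq' := by
    intro v i j hv hij
    have h0 : v 0 = v 1 := by
      fin_cases i <;> fin_cases j <;> simp_all
    have := congrArg Complex.im (hB (v 0) (v 0))
    rw [Complex.conj_im] at this
    simp only [← h0]
    linarith

/-- A smooth hermitian metric on a complex manifold `M` modelled on `E`: a positive definite
hermitian form (linear in the first and conjugate-linear in the second variable) on every
holomorphic tangent space, whose coefficients in every chart of the atlas are (real) smooth. -/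
structure HermitianMetric (E M : Type*) [NormedAddCommGroup E] [NormedSpace ℂ E]
    [NormedSpace ℝ E] [TopologicalSpace M] [ChartedSpace E M] where
  form : ∀ x : M, TangentSpace 𝓘(ℂ, E) x →L[ℂ] TangentSpace 𝓘(ℂ, E) x →L⋆[ℂ] ℂ
  conj_symm : ∀ (x : M) (v w : TangentSpace 𝓘(ℂ, E) x), form x w v = conj (form x v w)
  pos : ∀ (x : M) (v : TangentSpace 𝓘(ℂ, E) x), v ≠ 0 → 0 < (form x v v).re
  smooth : ∀ e ∈ atlas E M, ∀ v w : E,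
    ContDiffOn ℝ ∞ (fun y : E => form (e.symm y)
      (mfderiv 𝓘(ℂ, E) 𝓘(ℂ, E) e.symm y v) (mfderiv 𝓘(ℂ, E) 𝓘(ℂ, E) e.symm y w)) e.target

namespace HermitianMetric

variable {E M : Type*} [NormedAddCommGroup E] [NormedSpace ℂ E]
    [NormedSpace ℝ E] [TopologicalSpace M] [ChartedSpace E M]

/-- The conformal rescaling `ρ · h` of a hermitian metric by a smooth positive function. -/
def scale (h : HermitianMetric E M) (ρ : M → ℝ) (hpos : ∀ x, 0 < ρ x)
    (hsmooth : ∀ e ∈ atlas E M, ContDiffOn ℝ ∞ (fun y : E => ρ (e.symm y)) e.target) :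
    HermitianMetric E M where
  form x := (ρ x : ℂ) • h.form x
  conj_symm x v w := by simp [h.conj_symm x v w]
  pos x v hv := by
    have := mul_pos (hpos x) (h.pos x v hv)
    simpa using this
  smooth e he v w :=
    (Complex.ofRealCLM.contDiff.comp_contDiffOn (hsmooth e he)).mul (h.smooth e he v w)

/-- The pullback `φ^* Ω` of the fundamental form `Ω = -Im h` of `h`, a real 2-form on `F`. -/
def pullbackForm [IsScalarTower ℝ ℂ E] (h : HermitianMetric E M) {F : Type*}
    [NormedAddCommGroup F] [NormedSpace ℂ F] [NormedSpace ℝ F] [IsScalarTower ℝ ℂ F]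
    (φ : F → M) (y : F) : F [⋀^Fin 2]→L[ℝ] ℝ :=
  let D : F →L[ℂ] E := mfderiv 𝓘(ℂ, F) 𝓘(ℂ, E) φ y
  (fundamentalForm (E := E) (h.form (φ y)) (h.conj_symm (φ y))).compContinuousLinearMap
    (D.restrictScalars ℝ)

/-- The restriction of the hermitian metric `h` to the fibre `f ⁻¹ {b}` is Kähler: its fundamental
form is closed along the fibre. The fibre is described by holomorphic parametrizations, that is,
by the holomorphic immersions `φ` of open sets `W ⊆ ℂᵏ` with values in the fibre; for `k` the
dimension of the fibre of a submersion these are the inverses of its holomorphic charts. -/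
def IsKahlerOnFiber [IsScalarTower ℝ ℂ E] (h : HermitianMetric E M) {N : Type*} (f : M → N) (b : N) : Prop :=
  ∀ (k : ℕ) (W : Set (Fin k → ℂ)) (φ : (Fin k → ℂ) → M), IsOpen W →
    MDifferentiableOn 𝓘(ℂ, Fin k → ℂ) 𝓘(ℂ, E) φ W →
    (∀ y ∈ W, Function.Injective (mfderiv 𝓘(ℂ, Fin k → ℂ) 𝓘(ℂ, E) φ y)) →
    (∀ y ∈ W, f (φ y) = b) →
    ∀ y ∈ W, extDeriv (h.pullbackForm φ) y = 0

end HermitianMetric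

/-! ### The fibre product as a quotient of `ℂ × ℍ × ℍ` -/

/-- `ℂ × ℍ × ℍ`, with coordinates `(z, α, s)`, as an open subset of `ℂ³`. -/
def Cover : TopologicalSpace.Opens (ℂ × ℂ × ℂ) where
  carrier := {p | 0 < p.2.1.im ∧ 0 < p.2.2.im}
  is_open' := IsOpen.and
    (isOpen_lt continuous_const (Complex.continuous_im.comp
      (continuous_fst.comp continuous_snd)))
    (isOpen_lt continuous_const (Complex.continuous_im.comp
      (continuous_snd.comp continuous_snd)))

namespace Cover

/-- The point `(z, α, s)`. -/
def mk (z : ℂ) (α s : ℍ) : Cover := ⟨(z, α, s), α.2, s.2⟩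

/-- The action of the group `{g_{n,m}}`, `g_{n,m} (z, α, s) = (z + n + m s, α, s)`. -/
instance : AddAction (ℤ × ℤ) Cover where
  vadd g p := ⟨(p.1.1 + g.1 + g.2 * p.1.2.2, p.1.2), p.2⟩
  zero_vadd p := Subtype.ext (Prod.ext (by
    change p.1.1 + ((0 : ℤ) : ℂ) + ((0 : ℤ) : ℂ) * p.1.2.2 = p.1.1
    simp) rfl)
  add_vadd g g' p := Subtype.ext (Prod.ext (by
    change p.1.1 + ((g.1 + g'.1 : ℤ) : ℂ) + ((g.2 + g'.2 : ℤ) : ℂ) * p.1.2.2 =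
      p.1.1 + g'.1 + g'.2 * p.1.2.2 + g.1 + g.2 * p.1.2.2
    push_cast; ring) rfl)

theorem coe_vadd (g : ℤ × ℤ) (p : Cover) :
    ((g +ᵥ p : Cover) : ℂ × ℂ × ℂ) = (p.1.1 + g.1 + g.2 * p.1.2.2, p.1.2) := rfl

instance : ContinuousConstVAdd (ℤ × ℤ) Cover where
  continuous_const_vadd g := by
    refine Continuous.subtype_mk (f := fun p : Cover =>
      (p.1.1 + g.1 + g.2 * p.1.2.2, p.1.2)) ?_ _
    fun_prop

instance : IsCancelVAdd (ℤ × ℤ) Cover where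
  right_cancel' g g' p h := by
    have h1 : p.1.1 + (g.1 : ℂ) + g.2 * p.1.2.2 = p.1.1 + g'.1 + g'.2 * p.1.2.2 :=
      congrArg (fun q : Cover => q.1.1) h
    have him := congrArg Complex.im h1
    have hre := congrArg Complex.re h1
    have hs : p.1.2.2.im ≠ 0 := p.2.2.ne'
    simp [hs] at him
    simp [him] at hre
    exact Prod.ext hre him

instance : LocallyCompactSpace Cover := Cover.isOpen.locallyCompactSpace

instance : ProperlyDiscontinuousVAdd (ℤ × ℤ) Cover where
  finite_disjoint_inter_image {K L} hK hL := by
    obtain ⟨R, hR⟩ := (hK.image (f := fun p : Cover => (p : ℂ × ℂ × ℂ))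
      continuous_subtype_val).isBounded.exists_norm_le
    obtain ⟨R', hR'⟩ := (hL.image (f := fun p : Cover => (p : ℂ × ℂ × ℂ))
      continuous_subtype_val).isBounded.exists_norm_le
    obtain ⟨δ, hδ, hKδ⟩ : ∃ δ > 0, ∀ p ∈ K, δ ≤ p.1.2.2.im := by
      rcases K.eq_empty_or_nonempty with rfl | hne
      · exact ⟨1, one_pos, by simp⟩
      · obtain ⟨p, hp, hmin⟩ := hK.exists_isMinOn hne
          (f := fun p : Cover => p.1.2.2.im) (Continuous.continuousOn
            (Complex.continuous_im.comp (continuous_snd.comp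
              (continuous_snd.comp continuous_subtype_val))))
        exact ⟨_, p.2.2, fun q hq => hmin hq⟩
    obtain ⟨A, hA⟩ := exists_nat_ge ((R + R') / δ)
    obtain ⟨B, hB⟩ := exists_nat_ge (R + R' + A * R)
    refine ((Set.finite_Icc (-(B : ℤ)) B).prod (Set.finite_Icc (-(A : ℤ)) A)).subset ?_
    rintro ⟨n, m⟩ ⟨_, ⟨p, hp, rfl⟩, hpL⟩
    have hpR := hR _ ⟨p, hp, rfl⟩
    have hgR := hR' _ ⟨_, hpL, rfl⟩
    have hz := (norm_fst_le (p : ℂ × ℂ × ℂ)).trans hpR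
    have hs := (norm_snd_le (p : ℂ × ℂ × ℂ).2).trans ((norm_snd_le (p : ℂ × ℂ × ℂ)).trans hpR)
    have hz' : ‖p.1.1 + n + m * p.1.2.2‖ ≤ R' := (norm_fst_le _).trans hgR
    have hdiff : ‖(n : ℂ) + m * p.1.2.2‖ ≤ R + R' := by
      have := norm_sub_le (p.1.1 + n + m * p.1.2.2) p.1.1
      rw [show p.1.1 + n + m * p.1.2.2 - p.1.1 = (n : ℂ) + m * p.1.2.2 by ring] at this
      linarith
    have him : |(m : ℝ)| * p.1.2.2.im ≤ R + R' := by
      have := (Complex.abs_im_le_norm _).trans hdiff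
      simpa [abs_mul, abs_of_pos p.2.2] using this
    have hm : |(m : ℝ)| ≤ A := by
      refine le_trans ?_ hA
      rw [le_div_iff₀ hδ]
      exact (mul_le_mul_of_nonneg_left (hKδ p hp) (abs_nonneg _)).trans him
    have hn : |(n : ℝ)| ≤ B := by
      have h1 := norm_sub_le ((n : ℂ) + m * p.1.2.2) (m * p.1.2.2)
      rw [add_sub_cancel_right, norm_mul, Complex.norm_intCast, Complex.norm_intCast] at h1
      have h2 : |(m : ℝ)| * ‖p.1.2.2‖ ≤ A * R :=
        mul_le_mul hm hs (norm_nonneg _) (Nat.cast_nonneg _)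
      linarith
    refine ⟨abs_le.1 ?_, abs_le.1 ?_⟩
    · exact_mod_cast hn
    · exact_mod_cast hm

end Cover

/-- The fibre product `𝒳 ×_ℍ 𝒦` of the universal family of marked elliptic curves and the
fibration of complexified Kähler cones. Its topology and its charts (the local inverses of the
quotient map) are those of the quotient of a manifold by a free, properly discontinuous action. -/
abbrev FiberProduct : Type := AddAction.orbitRel.Quotient (ℤ × ℤ) Cover

namespace FiberProduct

/-- The quotient map `q`. -/
def proj (p : Cover) : FiberProduct := Quotient.mk _ p

/-- The fibration `ν`, induced by `(z, α, s) ↦ s`. -/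
def nu : FiberProduct → ℍ :=
  Quotient.lift (fun p : Cover => (⟨p.1.2.2, p.2.2⟩ : ℍ)) (by
    rintro _ p ⟨g, rfl⟩; rfl)

/-- The fibration `η`, induced by `(z, α, s) ↦ α`. -/
def eta : FiberProduct → ℍ :=
  Quotient.lift (fun p : Cover => (⟨p.1.2.1, p.2.1⟩ : ℍ)) (by
    rintro _ p ⟨g, rfl⟩; rfl)

theorem chart_symm {e : OpenPartialHomeomorph FiberProduct (ℂ × ℂ × ℂ)}
    (he : e ∈ atlas (ℂ × ℂ × ℂ) FiberProduct) {y : ℂ × ℂ × ℂ} (hy : y ∈ e.target) :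
    ∃ hc : y ∈ Cover, e.symm y = proj ⟨y, hc⟩ := by
  obtain ⟨q, rfl⟩ := he
  set p : Cover := Exists.choose (p := fun g : FiberProduct → Cover =>
    Function.RightInverse g (Quotient.mk _)) (Quotient.mk_surjective.hasRightInverse) q
  have hy1 : y ∈ (chartAt (ℂ × ℂ × ℂ) p).target := hy.1
  have hc : ((chartAt (ℂ × ℂ × ℂ) p).symm y : ℂ × ℂ × ℂ) = y :=
    (chartAt (ℂ × ℂ × ℂ) p).right_inv hy1
  refine ⟨hc ▸ ((chartAt (ℂ × ℂ × ℂ) p).symm y).2, ?_⟩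
  have hp : (chartAt (ℂ × ℂ × ℂ) p).symm y = ⟨y, hc ▸ ((chartAt (ℂ × ℂ × ℂ) p).symm y).2⟩ :=
    Subtype.ext hc
  rw [← hp, OpenPartialHomeomorph.trans_symm_eq_symm_trans_symm,
    OpenPartialHomeomorph.coe_trans, Function.comp, IsLocalHomeomorph.localInverseAt_symm]
  rfl

/-- The transition functions of the atlas are locally the deck transformations `g_{n,m}`. -/
theorem transition_eventuallyEq {e e' : OpenPartialHomeomorph FiberProduct (ℂ × ℂ × ℂ)}
    (he : e ∈ atlas (ℂ × ℂ × ℂ) FiberProduct) (he' : e' ∈ atlas (ℂ × ℂ × ℂ) FiberProduct)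
    {y : ℂ × ℂ × ℂ} (hy : y ∈ (e.symm ≫ₕ e').source) :
    ∃ n m : ℤ, (e.symm ≫ₕ e') =ᶠ[𝓝 y] fun x => (x.1 + n + m * x.2.2, x.2) := by
  have hmem : ∀ x ∈ (e.symm ≫ₕ e').source, x ∈ e.target ∧ e.symm x ∈ e'.source := fun x hx => by
    simpa using hx
  obtain ⟨hc, hq⟩ := chart_symm he (hmem y hy).1
  obtain ⟨hc', hq'⟩ := chart_symm he' (e'.map_source (hmem y hy).2)
  have hqq := (hq'.symm.trans (e'.left_inv (hmem y hy).2)).trans hq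
  obtain ⟨g, hg⟩ : ∃ g : ℤ × ℤ, g +ᵥ (⟨y, hc⟩ : Cover) = ⟨e' (e.symm y), hc'⟩ :=
    Quotient.exact hqq
  have hgy : (y.1 + g.1 + g.2 * y.2.2, y.2) = e' (e.symm y) := congrArg Subtype.val hg
  refine ⟨g.1, g.2, ?_⟩
  have hT : Continuous fun x : ℂ × ℂ × ℂ => (x.1 + (g.1 : ℂ) + g.2 * x.2.2, x.2) :=
    ((continuous_fst.add continuous_const).add
      (continuous_const.mul (continuous_snd.comp continuous_snd))).prodMk continuous_snd
  have h1 : ∀ᶠ x in 𝓝 y, (x.1 + (g.1 : ℂ) + g.2 * x.2.2, x.2) ∈ e'.target :=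
    hT.continuousAt.eventually_mem (e'.open_target.mem_nhds (by
      rw [hgy]; exact e'.map_source (hmem y hy).2))
  filter_upwards [h1, (e.symm ≫ₕ e').open_source.mem_nhds hy] with x hx1 hx
  obtain ⟨hcx, hqx⟩ := chart_symm he (hmem x hx).1
  obtain ⟨hcx', hqx'⟩ := chart_symm he' hx1
  have hsame : e'.symm (x.1 + (g.1 : ℂ) + g.2 * x.2.2, x.2) = e.symm x := by
    rw [hqx, hqx']
    exact Quotient.sound ⟨g, rfl⟩
  change e' (e.symm x) = _
  rw [← hsame, e'.right_inv hx1]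

instance : IsManifold 𝓘(ℂ, ℂ × ℂ × ℂ) ω FiberProduct := by
  refine isManifold_of_contDiffOn _ _ _ fun e e' he he' => ?_
  intro y hy
  obtain ⟨n, m, h⟩ := transition_eventuallyEq he he' (y := y) (by simpa using hy)
  have hT : ContDiff ℂ ω fun x : ℂ × ℂ × ℂ => (x.1 + (n : ℂ) + m * x.2.2, x.2) := by
    fun_prop
  exact (hT.contDiffAt.congr_of_eventuallyEq h).contDiffWithinAt

/-- The volume of `X_s` with respect to the complexified Kähler class `α` is `Im α`. -/
def vol (x : FiberProduct) : ℝ := (eta x).im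

theorem vol_pos (x : FiberProduct) : 0 < vol x := (eta x).im_pos

theorem contDiffOn_inv_vol {e : OpenPartialHomeomorph FiberProduct (ℂ × ℂ × ℂ)}
    (he : e ∈ atlas (ℂ × ℂ × ℂ) FiberProduct) :
    ContDiffOn ℝ ∞ (fun y => (vol (e.symm y))⁻¹) e.target := by
  have h : ContDiffOn ℝ ∞ (fun y : ℂ × ℂ × ℂ => (y.2.1.im)⁻¹) e.target := by
    refine ContDiffOn.inv ?_ fun y hy => ?_
    · exact (Complex.imCLM.contDiff.comp (contDiff_fst.comp contDiff_snd)).contDiffOn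
    · obtain ⟨hc, -⟩ := chart_symm he hy
      exact hc.1.ne'
  refine h.congr fun y hy => ?_
  obtain ⟨hc, hq⟩ := chart_symm he hy
  rw [hq]
  rfl

/-- The normalized metric `ω_U = ω / Vol(X_s, α)`. -/
def normalized (h : HermitianMetric (ℂ × ℂ × ℂ) FiberProduct) :
    HermitianMetric (ℂ × ℂ × ℂ) FiberProduct :=
  h.scale (fun x => (vol x)⁻¹) (fun x => inv_pos.2 (vol_pos x)) fun _ he => contDiffOn_inv_vol he

end FiberProduct

/-! ### The natural metric

Functions and forms on `X_s = ℂ / (ℤ + s ℤ)` are written as functions of `z ∈ ℂ`. A hermitian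
metric on `X_s` is `u |dz|²`, with fundamental form `u (i/2) dz ∧ dz̄ = u dx ∧ dy`; the pointwise
norms that it induces are `|∂_z|² = u`, `|dz|² = |dz̄|² = 1 / u`. A class in `H^{1,1}(X_s, ℂ)` is
identified with its integral over `X_s`; thus `α` stands for `(α / Im s) (i/2) dz ∧ dz̄`. -/

namespace Elliptic

/-- The operator `∂/∂z`. -/
def dz (f : ℂ → ℂ) (z : ℂ) : ℂ := (fderiv ℝ f z 1 - Complex.I * fderiv ℝ f z Complex.I) / 2

/-- The operator `∂/∂z̄`. -/
def dzbar (f : ℂ → ℂ) (z : ℂ) : ℂ := (fderiv ℝ f z 1 + Complex.I * fderiv ℝ f z Complex.I) / 2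

/-- `f` descends to a function on `X_s`. -/
def IsPeriodic {A : Type*} (s : ℍ) (f : ℂ → A) : Prop :=
  ∀ (n m : ℤ) (z : ℂ), f (z + n + m * s) = f z

/-- The integral `∫_{X_s} f dx ∧ dy`, computed on the fundamental parallelogram spanned by
`1` and `s`. -/
def integral (s : ℍ) (f : ℂ → ℂ) : ℂ :=
  ∫ z in (fun t : ℝ × ℝ => (t.1 : ℂ) + t.2 * (s : ℂ)) '' (Set.Ico 0 1 ×ˢ Set.Ico 0 1), f z

/-- `u |dz|²` is a Ricci-flat Kähler metric on `X_s` whose Kähler form lies in the class with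
integral `c`; its Ricci form is `-i ∂∂̄ log u`. -/
structure IsRicciFlat (s : ℍ) (c : ℝ) (u : ℂ → ℝ) : Prop where
  smooth : ContDiff ℝ ∞ u
  periodic : IsPeriodic s u
  pos : ∀ z, 0 < u z
  ricci : ∀ z, dz (dzbar fun w => (Real.log (u w) : ℂ)) z = 0
  integral_eq : integral s (fun z => (u z : ℂ)) = c

/-- The `(1,1)`-form `f (i/2) dz ∧ dz̄` on `X_s` is harmonic with respect to the metric `u |dz|²`
(it is closed, and co-closed as its Hodge dual `f / u` is closed), and its class has integral
`c`. -/
structure IsHarmonicForm (s : ℍ) (u : ℂ → ℝ) (c : ℂ) (f : ℂ → ℂ) : Prop where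
  smooth : ContDiff ℝ ∞ f
  periodic : IsPeriodic s f
  coclosed : ∀ z, fderiv ℝ (fun w => f w / u w) z = 0
  integral_eq : integral s f = c

/-- The vector field `∂_s + b ∂_z` along `X_s` is the canonical lift of `∂_s` to the universal
family with respect to the metric `u |dz|²`. It is invariant under the maps
`(z, s) ↦ (z + n + m s, s)`; the `(0,1)`-form `(∂b/∂z̄) dz̄ ⊗ ∂_z` with values in `T_{X_s}`, which
represents the Kodaira-Spencer class of `∂_s`, is harmonic, that is, it is annihilated by the
adjoint of `∂̄`: integrating by parts in `∫ (∂g/∂z̄) conj(k) u dx ∧ dy`, the `L²` product of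
`∂̄ (g ∂_z)` and `k dz̄ ⊗ ∂_z`, this means `∂_z (u k) = 0`; and the lift is tangent to the zero section
`z = 0` of the family. -/
structure IsCanonicalLift (s : ℍ) (u : ℂ → ℝ) (b : ℂ → ℂ) : Prop where
  smooth : ContDiff ℝ ∞ b
  equivariant : ∀ (n m : ℤ) (z : ℂ), b (z + n + m * s) = b z + m
  harmonic : ∀ z, dz (fun w => u w * dzbar b w) z = 0
  zero_section : b 0 = 0

/-- The `L²` norm squared of the `(1,1)`-form `f (i/2) dz ∧ dz̄`: the integral over `X_s` of the
pointwise norm squared `|f|² / (4 u²)` against the volume form `u dx ∧ dy`. -/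
def normSqForm (s : ℍ) (u : ℂ → ℝ) (f : ℂ → ℂ) : ℂ :=
  integral s fun z => ((‖f z‖ ^ 2 / (4 * u z ^ 2) * u z : ℝ) : ℂ)

/-- The `L²` norm squared of the `(0,1)`-form `k dz̄ ⊗ ∂_z` with values in `T_{X_s}`: the integral
over `X_s` of the pointwise norm squared `|k|²` against the volume form `u dx ∧ dy`. -/
def normSqKS (s : ℍ) (u : ℂ → ℝ) (k : ℂ → ℂ) : ℂ :=
  integral s fun z => ((‖k z‖ ^ 2 * u z : ℝ) : ℂ)

end Elliptic

open Elliptic in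
/-- `h` is the natural hermitian metric. For given `α` and `s`, let `u |dz|²` be the Ricci-flat
Kähler metric on `X_s` in the class `Im α`, let `f` be the harmonic form in the class `∂_α` (of
integral `1`), and let `b` be the canonical lift. As classes of constant period are flat for the
Gauss-Manin connection, the lift of `∂_s` to the fibre product is `∂_s + b ∂_z`, so the tangent
vector `v = (v_z, v_α, v_s)` at `(z, α, s)` splits into its part `(v_z - b v_s) ∂_z` in
`T_{X_s}`, its part `v_α ∂_α` in `H^{1,1}(X_s, ℂ)` and the lift of `v_s ∂_s`. The natural metric
makes this splitting orthogonal, and is given on the three parts by the metric `u |dz|²`, by the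
`L²` metric on harmonic forms, and by the `L²` metric on Kodaira-Spencer classes. -/
def IsNaturalMetric (h : HermitianMetric (ℂ × ℂ × ℂ) FiberProduct) : Prop :=
  ∀ α s : ℍ, ∃ (u : ℂ → ℝ) (f b : ℂ → ℂ),
    IsRicciFlat s α.im u ∧ IsHarmonicForm s u 1 f ∧ IsCanonicalLift s u b ∧
    ∀ (z : ℂ) (v w : ℂ × ℂ × ℂ),
      h.form (FiberProduct.proj (Cover.mk z α s))
        (mfderiv 𝓘(ℂ, ℂ × ℂ × ℂ) 𝓘(ℂ, ℂ × ℂ × ℂ) FiberProduct.proj (Cover.mk z α s) v)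
        (mfderiv 𝓘(ℂ, ℂ × ℂ × ℂ) 𝓘(ℂ, ℂ × ℂ × ℂ) FiberProduct.proj (Cover.mk z α s) w) =
      u z * (v.1 - b z * v.2.2) * conj (w.1 - b z * w.2.2)
        + normSqForm s u f * v.2.1 * conj w.2.1
        + normSqKS s u (dzbar b) * v.2.2 * conj w.2.2

end

/-!
Both assertions follow from an explicit formula for the metric. A function `g` on `ℂ` with
`∂²g/∂z∂z̄ = 0` whose periods are `0` along `1` and `τ` along `s` is `g 0 + τ Im z / Im s`: the
functions `conj (∂g/∂z̄)` and `∂g/∂z` descend to the compact curve, so Liouville's theorem makes them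
constant (`Elliptic.eq_of_dz_dzbar_eq_zero`). Applied to `log u` and to `b`, this shows that the
only possible data are `u = Im α / Im s`, `f = 1 / Im s` and `b = Im z / Im s`; the integrals over
`X_s` reduce to the area `Im s` of the fundamental parallelogram. The resulting form
`FiberProduct.naturalForm` on `ℂ³` is invariant under the deck transformations, so it descends to a
metric, and as the differential of the quotient map is bijective, that metric is the only one
(`FiberProduct.isNaturalMetric_naturalMetric`, `FiberProduct.eq_naturalMetric`).

For the Kähler property, write `z = a + t s` with `a` and `t` real. After division by `Im α` the
fundamental form upstairs is
`da ∧ dt + d(Re α) ∧ d(Im α) / (4 (Im α)²) + d(Re s) ∧ d(Im s) / (4 (Im s)²)`,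
which is exact (`FiberProduct.extDeriv_primitive_apply`), hence closed on the whole fibre product
and in particular on the fibres of both fibrations. To pull this back along a holomorphic
parametrization of a fibre, one needs the latter to be twice continuously differentiable; this is
proved from complex differentiability alone by Cauchy's formula on complex lines
(`contDiffOn_of_differentiableOn_complex`).
-/

/-! ### Holomorphic maps of several variables are smooth -/

section SeveralVariables

variable {E F : Type*} [NormedAddCommGroup E] [NormedSpace ℂ E] [FiniteDimensional ℂ E]
  [NormedAddCommGroup F] [NormedSpace ℂ F] [FiniteDimensional ℂ F]

/-- A directional derivative of a holomorphic map is holomorphic: Cauchy's formula writes it as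
a circle integral, and the Schwarz lemma bounds the derivative locally, which allows
differentiation under the integral sign. -/
theorem differentiableOn_fderiv_apply_of_complex {U : Set E} (hU : IsOpen U) {f : E → F}
    (hf : DifferentiableOn ℂ f U) (v : E) : DifferentiableOn ℂ (fun x => fderiv ℂ f x v) U := by
  have : CompleteSpace F := FiniteDimensional.complete ℂ F
  have : ProperSpace (E →L[ℂ] F) := FiniteDimensional.proper ℂ _
  borelize E
  borelize (E →L[ℂ] F)
  intro x₀ hx₀
  refine DifferentiableAt.differentiableWithinAt ?_
  obtain ⟨R, hR, hball⟩ : ∃ R > 0, ∀ x ∈ Metric.ball x₀ (4 * R), x ∈ U ∧ ‖f x‖ < ‖f x₀‖ + 1 := by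
    have h1 : ∀ᶠ x in 𝓝 x₀, x ∈ U ∧ ‖f x‖ < ‖f x₀‖ + 1 :=
      Filter.Eventually.and (hU.mem_nhds hx₀) ((hf.differentiableAt (hU.mem_nhds hx₀)).continuousAt.norm.eventually
        (gt_mem_nhds (lt_add_one _)))
    obtain ⟨ε, hε, h⟩ := Metric.eventually_nhds_iff_ball.1 h1
    exact ⟨ε / 4, by positivity, fun x hx => h x (by convert hx using 2; ring)⟩
  set M := ‖f x₀‖ + 1 with hM
  have hdf (x) (hx : x ∈ Metric.ball x₀ (2 * R)) : ‖fderiv ℂ f x‖ ≤ 2 * M / (2 * R) := by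
    have hsub : Metric.ball x (2 * R) ⊆ Metric.ball x₀ (4 * R) :=
      Metric.ball_subset_ball' (by rw [Metric.mem_ball] at hx; linarith)
    refine Complex.norm_fderiv_le_div_of_mapsTo_ball
      (hf.mono fun y hy => (hball y (hsub hy)).1) (fun y hy => ?_) (by positivity)
    rw [Metric.mem_closedBall, dist_eq_norm]
    have h1 := (hball y (hsub hy)).2
    have h2 := (hball x (hsub (Metric.mem_ball_self (by positivity)))).2
    exact (norm_sub_le _ _).trans (by linarith)
  set r := R / (‖v‖ + 1) with hr
  have hr0 : 0 < r := by positivity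
  have hrv : r * ‖v‖ < R := by
    rw [hr, div_mul_eq_mul_div, div_lt_iff₀ (by positivity)]
    linarith
  have hmem (x) (hx : x ∈ Metric.ball x₀ R) (ζ : ℂ) (hζ : ‖ζ‖ ≤ r) :
      x + ζ • v ∈ Metric.ball x₀ (2 * R) := by
    rw [Metric.mem_ball, dist_eq_norm] at hx ⊢
    have h1 : ‖ζ • v‖ < R := by
      rw [norm_smul]
      exact (mul_le_mul_of_nonneg_right hζ (norm_nonneg _)).trans_lt hrv
    calc ‖x + ζ • v - x₀‖ = ‖(x - x₀) + ζ • v‖ := by congr 1; abel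
      _ ≤ _ := norm_add_le _ _
      _ < _ := by linarith
  have hmemU (x) (hx : x ∈ Metric.ball x₀ R) (ζ : ℂ) (hζ : ‖ζ‖ ≤ r) : x + ζ • v ∈ U :=
    (hball _ (Metric.ball_subset_ball (by linarith) (hmem x hx ζ hζ))).1
  have hcirc (θ : ℝ) : ‖circleMap 0 r θ‖ = r := by simp [abs_of_pos hr0]
  -- the kernel of Cauchy's formula for the first derivative
  let c : ℝ → ℂ := fun θ => deriv (circleMap 0 r) θ * ((circleMap 0 r θ - 0) ^ 2)⁻¹
  have hc : Continuous c := by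
    refine Continuous.mul ?_ (Continuous.inv₀ (by fun_prop) fun θ => ?_)
    · rw [show deriv (circleMap 0 r) = fun θ => circleMap 0 r θ * Complex.I from
        funext fun θ => by simp]
      fun_prop
    · rw [sub_zero]
      exact pow_ne_zero _ (norm_ne_zero_iff.1 (by rw [hcirc]; exact hr0.ne'))
  let G : E → ℝ → F := fun x θ => c θ • f (x + circleMap 0 r θ • v)
  have hformula : ∀ x ∈ Metric.ball x₀ R, fderiv ℂ f x v =
      (2 * (Real.pi : ℂ) * Complex.I)⁻¹ • ∫ θ in (0 : ℝ)..2 * Real.pi, G x θ := by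
    intro x hx
    have hline : Continuous fun ζ : ℂ => x + ζ • v := by fun_prop
    have hd : DifferentiableOn ℂ (fun ζ : ℂ => f (x + ζ • v)) ((fun ζ : ℂ => x + ζ • v) ⁻¹' U) :=
      hf.comp (by fun_prop) fun ζ hζ => hζ
    have h := Complex.two_pi_I_inv_smul_circleIntegral_sub_sq_inv_smul_of_differentiable
      (hU.preimage hline) (c := 0) (w₀ := 0) (R := r)
      (fun ζ hζ => hmemU x hx ζ (by simpa using hζ)) hd (Metric.mem_ball_self hr0)
    have hxU : x ∈ U := by simpa using hmemU x hx 0 (by simpa using hr0.le)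
    have hderiv : deriv (fun ζ : ℂ => f (x + ζ • v)) 0 = fderiv ℂ f x v :=
      (hf.differentiableAt (hU.mem_nhds hxU)).lineDeriv_eq_fderiv
    rw [← hderiv, ← h, circleIntegral]
    simp only [G, c, mul_smul]
  have hcont (x) (hx : x ∈ Metric.ball x₀ R) : Continuous (G x) := by
    refine hc.smul (continuous_iff_continuousAt.2 fun θ => ?_)
    refine ContinuousAt.comp (f := fun θ => x + circleMap 0 r θ • v) ?_
      (by fun_prop)
    exact (hf.differentiableAt (hU.mem_nhds (hmemU x hx _ (hcirc θ).le))).continuousAt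
  have key := intervalIntegral.hasFDerivAt_integral_of_dominated_of_fderiv_le
    (μ := MeasureTheory.volume) (𝕜 := ℂ) (F := G) (x₀ := x₀) (a := 0) (b := 2 * Real.pi)
    (F' := fun x θ => c θ • fderiv ℂ f (x + circleMap 0 r θ • v))
    (bound := fun θ => ‖c θ‖ * (2 * M / (2 * R))) (Metric.ball_mem_nhds x₀ hR)
    (Filter.eventually_of_mem (Metric.ball_mem_nhds x₀ hR) fun x hx =>
      (hcont x hx).aestronglyMeasurable)
    ((hcont x₀ (Metric.mem_ball_self hR)).intervalIntegrable _ _)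
    (hc.aestronglyMeasurable.smul ((measurable_fderiv ℂ f).comp
      (by fun_prop : Continuous fun θ => x₀ + circleMap 0 r θ • v).measurable).aestronglyMeasurable)
    (Filter.Eventually.of_forall fun θ _ x hx => by
      rw [norm_smul]
      exact mul_le_mul_of_nonneg_left (hdf _ (hmem x hx _ (hcirc θ).le)) (norm_nonneg _))
    (Continuous.intervalIntegrable (by fun_prop) _ _)
    (Filter.Eventually.of_forall fun θ _ x hx => by
      have h1 := (hf.differentiableAt (hU.mem_nhds (hmemU x hx _ (hcirc θ).le))).hasFDerivAt
      exact (h1.comp x ((hasFDerivAt_id x).add_const _)).const_smul (c θ))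
  refine (key.differentiableAt.const_smul
    (2 * (Real.pi : ℂ) * Complex.I)⁻¹).congr_of_eventuallyEq ?_
  exact Filter.eventually_of_mem (Metric.ball_mem_nhds x₀ hR) hformula

/-- Complex differentiable maps of several variables are `C^n` for every finite `n`, by induction on
`n`: all directional derivatives are again complex differentiable. -/
theorem contDiffOn_of_differentiableOn_complex {U : Set E} (hU : IsOpen U) {f : E → F}
    (hf : DifferentiableOn ℂ f U) (n : ℕ) : ContDiffOn ℂ n f U := by
  induction n generalizing f with
  | zero => exact contDiffOn_zero.2 hf.continuousOn
  | succ n ih =>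
    rw [Nat.cast_succ, contDiffOn_succ_iff_fderiv_of_isOpen hU]
    exact ⟨hf, fun h => absurd h (by simp),
      contDiffOn_clm_apply.2 fun v => ih (differentiableOn_fderiv_apply_of_complex hU hf v)⟩

end SeveralVariables

/-! ### Harmonic functions and integrals on an elliptic curve -/

namespace Elliptic

theorem IsPeriodic.isBounded_range {s : ℍ} {f : ℂ → ℂ} (hf : IsPeriodic s f)
    (hc : Continuous f) : Bornology.IsBounded (Set.range f) := by
  have hK : IsCompact ((fun t : ℝ × ℝ => f (t.1 + t.2 * (s : ℂ))) ''
      (Set.Icc 0 1 ×ˢ Set.Icc 0 1)) :=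
    (isCompact_Icc.prod isCompact_Icc).image (by fun_prop)
  refine hK.isBounded.subset ?_
  rintro _ ⟨z, rfl⟩
  have hs : s.im ≠ 0 := s.im_pos.ne'
  set t : ℝ := z.im / s.im with ht
  set r : ℝ := z.re - t * s.re with hr
  have hz : z = r + t * (s : ℂ) := by
    apply Complex.ext
    · simp [hr]
    · simp [ht, hs]
  refine ⟨(Int.fract r, Int.fract t), ⟨⟨Int.fract_nonneg _, (Int.fract_lt_one _).le⟩,
    ⟨Int.fract_nonneg _, (Int.fract_lt_one _).le⟩⟩, ?_⟩
  have h := hf ⌊r⌋ ⌊t⌋ ((Int.fract r : ℝ) + (Int.fract t : ℝ) * (s : ℂ))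
  have h1 : ((Int.fract r : ℝ) : ℂ) + ⌊r⌋ = r := by exact_mod_cast Int.fract_add_floor r
  have h2 : ((Int.fract t : ℝ) : ℂ) + ⌊t⌋ = t := by exact_mod_cast Int.fract_add_floor t
  simp only
  rw [← h, hz]
  congr 1
  linear_combination h1 + (s : ℂ) * h2

theorem contDiff_dzbar {g : ℂ → ℂ} (hg : ContDiff ℝ ∞ g) : ContDiff ℝ ∞ (dzbar g) := by
  have h : ContDiff ℝ ∞ (fderiv ℝ g) := hg.fderiv_right (by simp)
  exact ((h.clm_apply contDiff_const).add
    (contDiff_const.mul (h.clm_apply contDiff_const))).div_const 2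

theorem dz_const_mul (a : ℂ) (g : ℂ → ℂ) (z : ℂ) :
    dz (fun w => a * g w) z = a * dz g z := by
  have h : fderiv ℝ (fun w => a * g w) z = a • fderiv ℝ g z :=
    congrFun (fderiv_const_smul_field (𝕜 := ℝ) a) z
  simp only [dz, h, smul_apply, smul_eq_mul]
  ring

theorem fderiv_of_quasiPeriodic {s : ℍ} {g : ℂ → ℂ} {τ : ℂ}
    (hper : ∀ (n m : ℤ) (z : ℂ), g (z + n + m * s) = g z + m * τ) (n m : ℤ) (z : ℂ) :
    fderiv ℝ g (z + n + m * s) = fderiv ℝ g z := by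
  have h : (fun w => g (w + (n + m * s))) = fun w => g w + m * τ :=
    funext fun w => by rw [← hper n m w, add_assoc]
  rw [add_assoc, ← fderiv_comp_add_right, h, fderiv_add_const]

/-- A function `g` on `ℂ` with `∂²g/∂z∂z̄ = 0` and additive periods `0` along `1` and `τ` along `s`
is real affine. Both `conj (∂g/∂z̄)` and `∂g/∂z` descend to the compact curve and are holomorphic
there, hence constant. -/
theorem eq_of_dz_dzbar_eq_zero {s : ℍ} {g : ℂ → ℂ} {τ : ℂ} (hg : ContDiff ℝ ∞ g)
    (hper : ∀ (n m : ℤ) (z : ℂ), g (z + n + m * s) = g z + m * τ)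
    (hharm : ∀ z, dz (dzbar g) z = 0) (z : ℂ) : g z = g 0 + τ * (z.im / s.im : ℝ) := by
  have hfd := fderiv_of_quasiPeriodic hper
  have hk : ContDiff ℝ ∞ (dzbar g) := contDiff_dzbar hg
  obtain ⟨c, hc⟩ : ∃ c, ∀ z, dzbar g z = c := by
    have hhol : Differentiable ℂ fun w => conj (dzbar g w) := fun w => by
      have h1 : HasFDerivAt (fun w => conj (dzbar g w))
          ((Complex.conjCLE : ℂ →L[ℝ] ℂ).comp (fderiv ℝ (dzbar g) w)) w :=
        (Complex.conjCLE : ℂ →L[ℝ] ℂ).hasFDerivAt.comp w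
          (hk.differentiable (by simp) w).hasFDerivAt
      refine differentiableAt_complex_iff_differentiableAt_real.2 ⟨h1.differentiableAt, ?_⟩
      have h2 := hharm w
      rw [dz, div_eq_zero_iff, or_iff_left two_ne_zero, sub_eq_zero] at h2
      rw [h1.fderiv]
      simp [h2, ← mul_assoc]
    have hperk : IsPeriodic s fun w => conj (dzbar g w) := fun n m w => by
      simp only [dzbar, hfd]
    refine ⟨dzbar g 0, fun z => ?_⟩
    have := hhol.apply_eq_apply_of_bounded (hperk.isBounded_range hhol.continuous) z 0
    exact (starRingEnd ℂ).injective this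
  have hd (w : ℂ) : HasFDerivAt (fun w => g w - c * conj w)
      (fderiv ℝ g w - c • (Complex.conjCLE : ℂ →L[ℝ] ℂ)) w :=
    (hg.differentiable (by simp) w).hasFDerivAt.sub
      ((Complex.conjCLE : ℂ →L[ℝ] ℂ).hasFDerivAt.const_smul c)
  have hhol : Differentiable ℂ fun w => g w - c * conj w := fun w => by
    refine differentiableAt_complex_iff_differentiableAt_real.2 ⟨(hd w).differentiableAt, ?_⟩
    have h2 := hc w
    rw [dzbar, div_eq_iff two_ne_zero] at h2
    rw [(hd w).fderiv]
    simp
    linear_combination (-Complex.I) * h2 + fderiv ℝ g w Complex.I * Complex.I_sq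
  have hderiv (w : ℂ) : deriv (fun w => g w - c * conj w) w = fderiv ℝ g w 1 - c := by
    have h1 := ((hhol w).hasDerivAt.hasFDerivAt.restrictScalars ℝ).unique (hd w)
    simpa using DFunLike.congr_fun h1 1
  -- this derivative is `∂g/∂z`, since subtracting `c * conj w` removes the antiholomorphic part
  obtain ⟨d, hd'⟩ : ∃ d, ∀ z, deriv (fun w => g w - c * conj w) z = d := by
    have h1 : Differentiable ℂ (deriv fun w => g w - c * conj w) :=
      (hhol.contDiff (n := 2)).differentiable_deriv_two
    have h2 : IsPeriodic s (deriv fun w => g w - c * conj w) := fun n m w => by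
      simp only [hderiv, hfd]
    exact ⟨_, fun z => h1.apply_eq_apply_of_bounded (h2.isBounded_range h1.continuous) z 0⟩
  have haff (z : ℂ) : g z = g 0 + c * conj z + d * z := by
    have h1 : Differentiable ℂ fun w => g w - c * conj w - d * w := by fun_prop
    have h2 := is_const_of_deriv_eq_zero h1 (fun w => by
      rw [deriv_fun_sub (hhol w) (by fun_prop), hd']
      simp) z 0
    simp at h2
    linear_combination h2
  -- the periods along `1` and `s` determine `d = -c` and `c`
  have h1 := hper 1 0 0
  have h2 := hper 0 1 0
  have h3 := haff 1
  have h4 := haff s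
  simp at h1 h2 h3
  have hs : (s.im : ℂ) ≠ 0 := by exact_mod_cast s.im_pos.ne'
  have h5 : d = -c := by linear_combination h1 - h3
  have h6 : conj (s : ℂ) - s = -2 * Complex.I * s.im := by
    apply Complex.ext <;> simp
    ring
  have h7 : conj z - z = -2 * Complex.I * z.im := by
    apply Complex.ext <;> simp
    ring
  have h8 : τ = c * (-2 * Complex.I * s.im) := by
    rw [← h6]
    linear_combination h4 - h2 + (s : ℂ) * h5
  rw [haff z, h8]
  push_cast
  field_simp
  linear_combination z * h5 + c * h7

theorem volume_parallelogram (s : ℍ) :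
    MeasureTheory.volume ((fun t : ℝ × ℝ => (t.1 : ℂ) + t.2 * (s : ℂ)) ''
      (Set.Ico 0 1 ×ˢ Set.Ico 0 1)) = ENNReal.ofReal s.im := by
  let A : ℝ × ℝ →ₗ[ℝ] ℝ × ℝ := Matrix.toLin (Module.Basis.finTwoProd ℝ) (Module.Basis.finTwoProd ℝ)
    !![1, s.re; 0, s.im]
  have hA (t : ℝ × ℝ) : A t = (t.1 + s.re * t.2, s.im * t.2) := by
    simp [A, Matrix.toLin_finTwoProd_apply]
  have hdet : LinearMap.det A = s.im := by
    simp [A, LinearMap.det_toLin, Matrix.det_fin_two]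
  have himage : (fun t : ℝ × ℝ => (t.1 : ℂ) + t.2 * (s : ℂ)) '' (Set.Ico 0 1 ×ˢ Set.Ico 0 1) =
      Complex.measurableEquivRealProd ⁻¹' (A '' (Set.Ico 0 1 ×ˢ Set.Ico 0 1)) := by
    rw [← MeasurableEquiv.image_symm, Set.image_image]
    refine Set.image_congr fun t _ => ?_
    rw [hA, MeasurableEquiv.eq_symm_apply]
    ext <;> simp [Complex.measurableEquivRealProd_apply, mul_comm]
  rw [himage, Complex.volume_preserving_equiv_real_prod.measure_preimage_equiv,
    MeasureTheory.Measure.addHaar_image_linearMap, hdet, abs_of_pos s.im_pos,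
    MeasureTheory.Measure.volume_eq_prod, MeasureTheory.Measure.prod_prod]
  simp

theorem integral_const (s : ℍ) (c : ℂ) : integral s (fun _ => c) = s.im * c := by
  rw [integral, MeasureTheory.setIntegral_const, MeasureTheory.Measure.real, volume_parallelogram,
    ENNReal.toReal_ofReal s.im_pos.le, Complex.real_smul]

theorem dz_const (c z : ℂ) : dz (fun _ => c) z = 0 := by
  simp [dz]

theorem dzbar_const (c z : ℂ) : dzbar (fun _ => c) z = 0 := by
  simp [dzbar]

theorem dzbar_im_div (a : ℝ) (z : ℂ) :
    dzbar (fun w => ((w.im / a : ℝ) : ℂ)) z = Complex.I / (2 * a) := by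
  have h : HasFDerivAt (fun w : ℂ => ((w.im / a : ℝ) : ℂ))
      (Complex.ofRealCLM.comp (a⁻¹ • Complex.imCLM)) z := by
    have := (Complex.ofRealCLM.comp (a⁻¹ • Complex.imCLM)).hasFDerivAt (x := z)
    refine this.congr_of_eventuallyEq (Filter.Eventually.of_forall fun w => ?_)
    simp [div_eq_inv_mul]
  rw [dzbar, h.fderiv]
  simp
  ring

/-- The only Ricci-flat metric in the class of volume `c` is the flat one. -/
theorem isRicciFlat_iff {s : ℍ} {c : ℝ} (hc : 0 < c) {u : ℂ → ℝ} :
    IsRicciFlat s c u ↔ u = fun _ => c / s.im := by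
  have hs := s.im_pos
  constructor
  · intro h
    have hlog : ContDiff ℝ ∞ fun w => (Real.log (u w) : ℂ) :=
      Complex.ofRealCLM.contDiff.comp (h.smooth.log fun w => (h.pos w).ne')
    have h1 := eq_of_dz_dzbar_eq_zero (s := s) (τ := 0) hlog
      (fun n m w => by simp [h.periodic n m w]) h.ricci
    have h2 : u = fun _ => u 0 := funext fun z => by
      have h3 := h1 z
      rw [zero_mul, add_zero, Complex.ofReal_inj] at h3
      exact Real.log_injOn_pos (h.pos z) (h.pos 0) h3
    have h4 := h.integral_eq
    rw [h2, integral_const] at h4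
    rw [h2]
    funext _
    rw [eq_div_iff hs.ne', mul_comm]
    exact_mod_cast h4
  · rintro rfl
    refine ⟨contDiff_const, fun _ _ _ => rfl, fun _ => div_pos hc hs, fun z => ?_, ?_⟩
    · have : dzbar (fun _ : ℂ => ((Real.log (c / s.im) : ℝ) : ℂ)) = fun _ => 0 :=
        funext fun w => dzbar_const _ w
      rw [this, dz_const]
    · rw [integral_const]
      have : (s.im : ℂ) ≠ 0 := by exact_mod_cast hs.ne'
      push_cast
      field_simp

theorem isHarmonicForm_const_iff {s : ℍ} {a : ℝ} (ha : a ≠ 0) {c : ℂ} {f : ℂ → ℂ} :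
    IsHarmonicForm s (fun _ => a) c f ↔ f = fun _ => c / s.im := by
  have hs : (s.im : ℂ) ≠ 0 := by exact_mod_cast s.im_pos.ne'
  have ha' : (a : ℂ) ≠ 0 := by exact_mod_cast ha
  constructor
  · intro h
    have h2 : f = fun _ => f 0 := funext fun z => by
      have hd : Differentiable ℝ fun w => f w / ((a : ℝ) : ℂ) := by
        simpa only [div_eq_mul_inv] using (h.smooth.differentiable (by simp)).mul_const _
      have := is_const_of_fderiv_eq_zero hd h.coclosed z 0
      simpa [div_left_inj' ha'] using this
    have h4 := h.integral_eq
    rw [h2, integral_const] at h4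
    rw [h2]
    funext _
    rw [eq_div_iff hs, mul_comm]
    exact h4
  · rintro rfl
    refine ⟨contDiff_const, fun _ _ _ => rfl, fun z => by simp, ?_⟩
    rw [integral_const]
    field_simp

theorem isCanonicalLift_const_iff {s : ℍ} {a : ℝ} (ha : a ≠ 0) {b : ℂ → ℂ} :
    IsCanonicalLift s (fun _ => a) b ↔ b = fun z => ((z.im / s.im : ℝ) : ℂ) := by
  have ha' : (a : ℂ) ≠ 0 := by exact_mod_cast ha
  constructor
  · intro h
    funext z
    have hh (z : ℂ) : dz (dzbar b) z = 0 := by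
      have := h.harmonic z
      rw [dz_const_mul] at this
      exact (mul_eq_zero.1 this).resolve_left ha'
    rw [eq_of_dz_dzbar_eq_zero (s := s) (τ := 1) h.smooth (by simpa using h.equivariant) hh z,
      h.zero_section, zero_add, one_mul]
  · rintro rfl
    refine ⟨?_, fun n m z => ?_, fun z => ?_, by simp⟩
    · exact Complex.ofRealCLM.contDiff.comp (Complex.imCLM.contDiff.div_const _)
    · have hs : s.im ≠ 0 := s.im_pos.ne'
      norm_cast
      simp
      field_simp
    · rw [dz_const_mul, show dzbar (fun z => ((z.im / s.im : ℝ) : ℂ)) = fun _ => _ from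
        funext fun w => dzbar_im_div _ w, dz_const, mul_zero]

end Elliptic

noncomputable section

/-! ### The natural metric -/

/-- The hermitian form `ℓ ⊗ conj ℓ` of rank one defined by a linear functional `ℓ`. -/
def rankOneForm {E : Type*} [NormedAddCommGroup E] [NormedSpace ℂ E] (l : E →L[ℂ] ℂ) :
    E →L[ℂ] E →L⋆[ℂ] ℂ :=
  (innerSL ℂ : ℂ →L⋆[ℂ] ℂ →L[ℂ] ℂ).flip.bilinearComp l l

theorem rankOneForm_apply {E : Type*} [NormedAddCommGroup E] [NormedSpace ℂ E] (l : E →L[ℂ] ℂ)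
    (v w : E) : rankOneForm l v w = l v * conj (l w) := by
  simp [rankOneForm]

namespace FiberProduct

/-- The function `Im z / Im s`, the coordinate of `z` along `s` in the real basis `(1, s)`. -/
def slope (p : ℂ × ℂ × ℂ) : ℝ := p.1.im / p.2.2.im

/-- The natural metric in the coordinates `(z, α, s)`. -/
def naturalForm (p : ℂ × ℂ × ℂ) : (ℂ × ℂ × ℂ) →L[ℂ] (ℂ × ℂ × ℂ) →L⋆[ℂ] ℂ :=
  ((p.2.1.im / p.2.2.im : ℝ) : ℂ) • rankOneForm (ContinuousLinearMap.fst ℂ ℂ (ℂ × ℂ) -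
      (slope p : ℂ) • (ContinuousLinearMap.snd ℂ ℂ ℂ).comp (ContinuousLinearMap.snd ℂ ℂ (ℂ × ℂ))) +
    ((1 / (4 * p.2.1.im) : ℝ) : ℂ) •
      rankOneForm ((ContinuousLinearMap.fst ℂ ℂ ℂ).comp (ContinuousLinearMap.snd ℂ ℂ (ℂ × ℂ))) +
    ((p.2.1.im / (4 * p.2.2.im ^ 2) : ℝ) : ℂ) •
      rankOneForm ((ContinuousLinearMap.snd ℂ ℂ ℂ).comp (ContinuousLinearMap.snd ℂ ℂ (ℂ × ℂ)))

theorem naturalForm_apply (p v w : ℂ × ℂ × ℂ) : naturalForm p v w =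
    ((p.2.1.im / p.2.2.im : ℝ) : ℂ) * ((v.1 - slope p * v.2.2) * conj (w.1 - slope p * w.2.2)) +
      ((1 / (4 * p.2.1.im) : ℝ) : ℂ) * (v.2.1 * conj w.2.1) +
      ((p.2.1.im / (4 * p.2.2.im ^ 2) : ℝ) : ℂ) * (v.2.2 * conj w.2.2) := by
  simp [naturalForm, rankOneForm_apply]

/-- The linear part of the deck transformation `g_{n,m}`. -/
def deckLinear (m : ℤ) : (ℂ × ℂ × ℂ) →L[ℂ] (ℂ × ℂ × ℂ) :=
  (ContinuousLinearMap.fst ℂ ℂ (ℂ × ℂ) +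
      (m : ℂ) • (ContinuousLinearMap.snd ℂ ℂ ℂ).comp (ContinuousLinearMap.snd ℂ ℂ (ℂ × ℂ))).prod
    (ContinuousLinearMap.snd ℂ ℂ (ℂ × ℂ))

theorem deckLinear_apply (m : ℤ) (v : ℂ × ℂ × ℂ) :
    deckLinear m v = (v.1 + m * v.2.2, v.2) := rfl

/-- The deck transformation `g_{n,m}`, extended to `ℂ³`. -/
def deck (n m : ℤ) (p : ℂ × ℂ × ℂ) : ℂ × ℂ × ℂ := (p.1 + n + m * p.2.2, p.2)

theorem hasFDerivAt_deck (n m : ℤ) (p : ℂ × ℂ × ℂ) :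
    HasFDerivAt (deck n m) (deckLinear m) p := by
  have h : deck n m = fun p => deckLinear m p + ((n : ℂ), (0 : ℂ × ℂ)) := funext fun p => by
    rw [deckLinear_apply, Prod.mk_add_mk, add_zero, deck]
    congr 1
    ring
  rw [h]
  exact (deckLinear m).hasFDerivAt.add_const _

theorem deckLinear_surjective (m : ℤ) : Function.Surjective (deckLinear m) := fun v =>
  ⟨(v.1 - m * v.2.2, v.2), by simp [deckLinear_apply]⟩

/-- `naturalForm` is invariant under the deck transformations: `g_{n,m}` raises the slope by `m`, and
its differential adds `m v_s` to `v_z`, so that `v_z - slope * v_s` is unchanged. -/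
theorem naturalForm_deck (n m : ℤ) {p : ℂ × ℂ × ℂ} (hp : p ∈ Cover) (v w : ℂ × ℂ × ℂ) :
    naturalForm (deck n m p) (deckLinear m v) (deckLinear m w) = naturalForm p v w := by
  have hs : p.2.2.im ≠ 0 := hp.2.ne'
  have hslope : slope (deck n m p) = slope p + m := by
    simp [slope, deck]
    field_simp
  have hcancel (x : ℂ × ℂ × ℂ) :
      x.1 + m * x.2.2 - ((slope p + m : ℝ) : ℂ) * x.2.2 = x.1 - slope p * x.2.2 := by
    push_cast
    ring
  have h2 : (deck n m p).2 = p.2 := rfl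
  simp only [naturalForm_apply, deckLinear_apply, hslope, h2, hcancel]

theorem naturalForm_conj_symm (p v w : ℂ × ℂ × ℂ) :
    naturalForm p w v = conj (naturalForm p v w) := by
  simp only [naturalForm_apply, map_add, map_mul, Complex.conj_ofReal, Complex.conj_conj]
  ring

theorem naturalForm_pos {p : ℂ × ℂ × ℂ} (hp : p ∈ Cover) {v : ℂ × ℂ × ℂ} (hv : v ≠ 0) :
    0 < (naturalForm p v v).re := by
  have hα : 0 < p.2.1.im := hp.1
  have hs : 0 < p.2.2.im := hp.2
  have h : (naturalForm p v v).re = p.2.1.im / p.2.2.im * ‖v.1 - slope p * v.2.2‖ ^ 2 +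
      1 / (4 * p.2.1.im) * ‖v.2.1‖ ^ 2 + p.2.1.im / (4 * p.2.2.im ^ 2) * ‖v.2.2‖ ^ 2 := by
    rw [naturalForm_apply]
    simp only [Complex.mul_conj']
    norm_cast
  rw [h]
  by_cases h3 : v.2.2 = 0
  · by_cases h2 : v.2.1 = 0
    · have h1 : v.1 ≠ 0 := fun h1 => hv (Prod.ext h1 (Prod.ext h2 h3))
      have : 0 < ‖v.1 - slope p * v.2.2‖ := norm_pos_iff.2 (by simpa [h3] using h1)
      positivity
    · have : 0 < ‖v.2.1‖ := norm_pos_iff.2 h2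
      positivity
  · have : 0 < ‖v.2.2‖ := norm_pos_iff.2 h3
    positivity

theorem contDiffOn_naturalForm (v w : ℂ × ℂ × ℂ) :
    ContDiffOn ℝ ∞ (fun p => naturalForm p v w) Cover := by
  have h1 : ContDiff ℝ ∞ fun p : ℂ × ℂ × ℂ => p.1.im := Complex.imCLM.contDiff.comp contDiff_fst
  have h2 : ContDiff ℝ ∞ fun p : ℂ × ℂ × ℂ => p.2.1.im :=
    Complex.imCLM.contDiff.comp (contDiff_fst.comp contDiff_snd)
  have h3 : ContDiff ℝ ∞ fun p : ℂ × ℂ × ℂ => p.2.2.im :=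
    Complex.imCLM.contDiff.comp (contDiff_snd.comp contDiff_snd)
  have hα (p) (hp : p ∈ (Cover : Set (ℂ × ℂ × ℂ))) : p.2.1.im ≠ 0 := hp.1.ne'
  have hs (p) (hp : p ∈ (Cover : Set (ℂ × ℂ × ℂ))) : p.2.2.im ≠ 0 := hp.2.ne'
  have hslope : ContDiffOn ℝ ∞ slope Cover := h1.contDiffOn.div h3.contDiffOn hs
  have hre {f : ℂ × ℂ × ℂ → ℝ} (hf : ContDiffOn ℝ ∞ f Cover) :
      ContDiffOn ℝ ∞ (fun p => (f p : ℂ)) Cover := Complex.ofRealCLM.contDiff.comp_contDiffOn hf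
  have hlin (x : ℂ × ℂ × ℂ) : ContDiffOn ℝ ∞ (fun p => x.1 - slope p * x.2.2) Cover :=
    contDiffOn_const.sub ((hre hslope).mul contDiffOn_const)
  simp only [naturalForm_apply]
  refine (ContDiffOn.add ?_ ?_).add ?_
  · exact (hre (h2.contDiffOn.div h3.contDiffOn hs)).mul
      ((hlin v).mul (Complex.conjCLE.contDiff.comp_contDiffOn (hlin w)))
  · refine (hre (contDiffOn_const.div (contDiffOn_const.mul h2.contDiffOn) fun p hp => ?_)).mul
      contDiffOn_const
    exact mul_ne_zero four_ne_zero (hα p hp)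
  · refine (hre (h2.contDiffOn.div (contDiffOn_const.mul (h3.contDiffOn.pow 2)) fun p hp =>
      ?_)).mul contDiffOn_const
    exact mul_ne_zero four_ne_zero (pow_ne_zero _ (hs p hp))

/-- In a chart, a map to the fibre product that lifts to `ℂ³` is the lift followed by a deck
transformation. -/
theorem chart_comp_eventuallyEq {X : Type*} [TopologicalSpace X] {φ : X → FiberProduct}
    {ψ : X → ℂ × ℂ × ℂ} {x : X} (hψ : ContinuousAt ψ x)
    (hlift : ∀ᶠ y in 𝓝 x, ∃ hc : ψ y ∈ Cover, φ y = proj ⟨ψ y, hc⟩)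
    {e : OpenPartialHomeomorph FiberProduct (ℂ × ℂ × ℂ)} (he : e ∈ atlas (ℂ × ℂ × ℂ) FiberProduct)
    (hx : φ x ∈ e.source) : ∃ n m : ℤ, (fun y => e (φ y)) =ᶠ[𝓝 x] fun y => deck n m (ψ y) := by
  obtain ⟨hc, hq⟩ := hlift.self_of_nhds
  obtain ⟨hc', hq'⟩ := chart_symm he (e.map_source hx)
  have hqq := (hq'.symm.trans (e.left_inv hx)).trans hq
  obtain ⟨g, hg⟩ : ∃ g : ℤ × ℤ, g +ᵥ (⟨ψ x, hc⟩ : Cover) = ⟨e (φ x), hc'⟩ :=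
    Quotient.exact hqq
  have hgx : deck g.1 g.2 (ψ x) = e (φ x) := congrArg Subtype.val hg
  refine ⟨g.1, g.2, ?_⟩
  have h1 : ∀ᶠ y in 𝓝 x, deck g.1 g.2 (ψ y) ∈ e.target :=
    ((hasFDerivAt_deck g.1 g.2 (ψ x)).continuousAt.comp hψ).eventually_mem
      (e.open_target.mem_nhds (by
        rw [Function.comp_apply, hgx]
        exact e.map_source hx))
  filter_upwards [h1, hlift] with y hy hl
  obtain ⟨hcy, hqy⟩ := hl
  obtain ⟨hcy', hqy'⟩ := chart_symm he hy
  have hsame : φ y = e.symm (deck g.1 g.2 (ψ y)) := by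
    rw [hqy, hqy']
    exact (Quotient.sound ⟨g, rfl⟩ : proj (g +ᵥ ⟨ψ y, hcy⟩) = proj _).symm
  rw [hsame, e.right_inv hy]

/-- The differential of a map to the fibre product in terms of a local lift. -/
theorem mfderiv_eq_of_lift {F : Type*} [NormedAddCommGroup F] [NormedSpace ℂ F]
    {φ : F → FiberProduct} {ψ : F → ℂ × ℂ × ℂ} {x : F}
    (hφ : MDifferentiableAt 𝓘(ℂ, F) 𝓘(ℂ, ℂ × ℂ × ℂ) φ x) (hψ : DifferentiableAt ℂ ψ x)
    (hlift : ∀ᶠ y in 𝓝 x, ∃ hc : ψ y ∈ Cover, φ y = proj ⟨ψ y, hc⟩) :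
    ∃ n m : ℤ, chartAt (ℂ × ℂ × ℂ) (φ x) (φ x) = deck n m (ψ x) ∧
      ∀ v : F, (mfderiv 𝓘(ℂ, F) 𝓘(ℂ, ℂ × ℂ × ℂ) φ x v : ℂ × ℂ × ℂ) =
        deckLinear m (fderiv ℂ ψ x v) := by
  obtain ⟨n, m, h⟩ := chart_comp_eventuallyEq hψ.continuousAt hlift
    (chart_mem_atlas (ℂ × ℂ × ℂ) (φ x)) (mem_chart_source _ _)
  refine ⟨n, m, h.self_of_nhds, fun v => ?_⟩
  have h1 : HasFDerivAt (fun y => chartAt (ℂ × ℂ × ℂ) (φ x) (φ y))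
      ((deckLinear m).comp (fderiv ℂ ψ x)) x :=
    ((hasFDerivAt_deck n m (ψ x)).comp x hψ.hasFDerivAt).congr_of_eventuallyEq h
  rw [hφ.mfderiv]
  simp only [modelWithCornersSelf_coe, Set.range_id, fderivWithin_univ]
  have h2 : writtenInExtChartAt 𝓘(ℂ, F) 𝓘(ℂ, ℂ × ℂ × ℂ) x φ =
    fun y => chartAt (ℂ × ℂ × ℂ) (φ x) (φ y) := rfl
  rw [h2]
  exact DFunLike.congr_fun h1.fderiv v

/-- The differential of the quotient map is the linear part of a deck transformation. -/
theorem mfderiv_proj (p : Cover) :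
    ∃ n m : ℤ, chartAt (ℂ × ℂ × ℂ) (proj p) (proj p) = deck n m p ∧
      ∀ v : ℂ × ℂ × ℂ, (mfderiv 𝓘(ℂ, ℂ × ℂ × ℂ) 𝓘(ℂ, ℂ × ℂ × ℂ) proj p v : ℂ × ℂ × ℂ) =
        deckLinear m v := by
  have htarget : (p : ℂ × ℂ × ℂ) ∈ (chartAt (ℂ × ℂ × ℂ) p).target :=
    (chartAt (ℂ × ℂ × ℂ) p).map_source (mem_chart_source _ _)
  have hcoe (y) (hy : y ∈ (chartAt (ℂ × ℂ × ℂ) p).target) :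
      ((chartAt (ℂ × ℂ × ℂ) p).symm y : ℂ × ℂ × ℂ) = y :=
    (chartAt (ℂ × ℂ × ℂ) p).right_inv hy
  have hlift : ∀ᶠ y in 𝓝 (p : ℂ × ℂ × ℂ),
      ∃ hc : y ∈ Cover, proj ((chartAt (ℂ × ℂ × ℂ) p).symm y) = proj ⟨y, hc⟩ := by
    filter_upwards [(chartAt (ℂ × ℂ × ℂ) p).open_target.mem_nhds htarget] with y hy
    have h := ((chartAt (ℂ × ℂ × ℂ) p).symm y).2
    rw [hcoe y hy] at h
    exact ⟨h, congrArg proj (Subtype.ext (hcoe y hy))⟩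
  have hp : (chartAt (ℂ × ℂ × ℂ) p).symm (p : ℂ × ℂ × ℂ) = p := Subtype.ext (hcoe _ htarget)
  obtain ⟨n, m, h⟩ := chart_comp_eventuallyEq (ψ := id) continuousAt_id hlift
    (chart_mem_atlas (ℂ × ℂ × ℂ) (proj p)) (by rw [hp]; exact mem_chart_source _ _)
  have h1 : HasFDerivAt (writtenInExtChartAt 𝓘(ℂ, ℂ × ℂ × ℂ) 𝓘(ℂ, ℂ × ℂ × ℂ) p proj)
      (deckLinear m) (p : ℂ × ℂ × ℂ) :=
    (hasFDerivAt_deck n m p).congr_of_eventuallyEq h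
  have hdiff : MDifferentiableAt 𝓘(ℂ, ℂ × ℂ × ℂ) 𝓘(ℂ, ℂ × ℂ × ℂ) proj p :=
    ⟨(continuous_quot_mk : Continuous proj).continuousWithinAt, h1.differentiableAt.differentiableWithinAt⟩
  refine ⟨n, m, ?_, fun v => ?_⟩
  · simpa only [hp, id] using h.self_of_nhds
  · rw [hdiff.mfderiv]
    simp only [modelWithCornersSelf_coe, Set.range_id, fderivWithin_univ]
    exact DFunLike.congr_fun h1.fderiv v

theorem chartAt_self_mem_cover (x : FiberProduct) : chartAt (ℂ × ℂ × ℂ) x x ∈ Cover :=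
  (chart_symm (chart_mem_atlas _ x) ((chartAt (ℂ × ℂ × ℂ) x).map_source (mem_chart_source _ x))).1

/-- The form `naturalForm` on the tangent spaces of the fibre product, which are identified with
`ℂ³` by the preferred charts. -/
def tangentForm (x : FiberProduct) : TangentSpace 𝓘(ℂ, ℂ × ℂ × ℂ) x →L[ℂ]
    TangentSpace 𝓘(ℂ, ℂ × ℂ × ℂ) x →L⋆[ℂ] ℂ :=
  naturalForm (chartAt (ℂ × ℂ × ℂ) x x)

theorem tangentForm_eq_of_lift {F : Type*} [NormedAddCommGroup F] [NormedSpace ℂ F]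
    {φ : F → FiberProduct} {ψ : F → ℂ × ℂ × ℂ} {x : F}
    (hφ : MDifferentiableAt 𝓘(ℂ, F) 𝓘(ℂ, ℂ × ℂ × ℂ) φ x) (hψ : DifferentiableAt ℂ ψ x)
    (hlift : ∀ᶠ y in 𝓝 x, ∃ hc : ψ y ∈ Cover, φ y = proj ⟨ψ y, hc⟩) (v w : F) :
    tangentForm (φ x) (mfderiv 𝓘(ℂ, F) 𝓘(ℂ, ℂ × ℂ × ℂ) φ x v)
      (mfderiv 𝓘(ℂ, F) 𝓘(ℂ, ℂ × ℂ × ℂ) φ x w) =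
      naturalForm (ψ x) (fderiv ℂ ψ x v) (fderiv ℂ ψ x w) := by
  obtain ⟨n, m, h1, h2⟩ := mfderiv_eq_of_lift hφ hψ hlift
  obtain ⟨hc, -⟩ := hlift.self_of_nhds
  rw [← naturalForm_deck n m hc, ← h1, ← h2, ← h2]
  rfl

/-- The natural metric of the fibre product. -/
def naturalMetric : HermitianMetric (ℂ × ℂ × ℂ) FiberProduct where
  form := tangentForm
  conj_symm x v w := naturalForm_conj_symm _ v w
  pos x v hv := naturalForm_pos (chartAt_self_mem_cover x) hv
  smooth e he v w := by
    refine ((contDiffOn_naturalForm v w).mono fun y hy => (chart_symm he hy).1).congr fun y hy => ?_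
    have := tangentForm_eq_of_lift (φ := e.symm) (ψ := id)
      (mdifferentiableAt_atlas_symm he hy) differentiableAt_id
      (Filter.eventually_of_mem (e.open_target.mem_nhds hy) fun z hz => chart_symm he hz) v w
    simpa using this

/-- In the coordinates `(z, α, s)` of the universal cover, `tangentForm` is `naturalForm`. -/
theorem tangentForm_proj (p : Cover) (v w : ℂ × ℂ × ℂ) :
    tangentForm (proj p) (mfderiv 𝓘(ℂ, ℂ × ℂ × ℂ) 𝓘(ℂ, ℂ × ℂ × ℂ) proj p v)
      (mfderiv 𝓘(ℂ, ℂ × ℂ × ℂ) 𝓘(ℂ, ℂ × ℂ × ℂ) proj p w) = naturalForm p v w := by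
  obtain ⟨n, m, h1, h2⟩ := mfderiv_proj p
  rw [← naturalForm_deck n m p.2, ← h1, ← h2, ← h2]
  rfl

open Elliptic in
/-- The coefficients of the natural metric: the flat metric `u = Im α / Im s`, the harmonic form
`f = 1 / Im s` and the canonical lift `b = Im z / Im s`. -/
theorem isNaturalMetric_iff (h : HermitianMetric (ℂ × ℂ × ℂ) FiberProduct) :
    IsNaturalMetric h ↔ ∀ (p : Cover) (v w : ℂ × ℂ × ℂ),
      h.form (proj p) (mfderiv 𝓘(ℂ, ℂ × ℂ × ℂ) 𝓘(ℂ, ℂ × ℂ × ℂ) proj p v)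
        (mfderiv 𝓘(ℂ, ℂ × ℂ × ℂ) 𝓘(ℂ, ℂ × ℂ × ℂ) proj p w) = naturalForm p v w := by
  -- the prescribed formula, with these data and their `L²` norms inserted
  have hcoeff (α s : ℍ) (z : ℂ) (v w : ℂ × ℂ × ℂ) :
      ((α.im / s.im : ℝ) : ℂ) * (v.1 - ((z.im / s.im : ℝ) : ℂ) * v.2.2) *
            conj (w.1 - ((z.im / s.im : ℝ) : ℂ) * w.2.2)
          + normSqForm s (fun _ => α.im / s.im) (fun _ => 1 / s.im) * v.2.1 * conj w.2.1
          + normSqKS s (fun _ => α.im / s.im) (dzbar fun z => ((z.im / s.im : ℝ) : ℂ)) *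
            v.2.2 * conj w.2.2 = naturalForm (z, α, s) v w := by
    have hα := α.im_pos
    have hs := s.im_pos
    have hf : normSqForm s (fun _ => α.im / s.im) (fun _ => 1 / s.im) =
        ((1 / (4 * α.im) : ℝ) : ℂ) := by
      rw [normSqForm, integral_const, ← Complex.ofReal_mul, Complex.ofReal_inj]
      simp only [norm_div, norm_one, Complex.norm_real, Real.norm_of_nonneg hs.le]
      field_simp
    have hb : normSqKS s (fun _ => α.im / s.im) (dzbar fun z => ((z.im / s.im : ℝ) : ℂ)) =
        ((α.im / (4 * s.im ^ 2) : ℝ) : ℂ) := by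
      simp only [normSqKS, dzbar_im_div]
      rw [integral_const, ← Complex.ofReal_mul, Complex.ofReal_inj]
      simp only [norm_div, norm_mul, Complex.norm_I, Complex.norm_ofNat, Complex.norm_real,
        Real.norm_of_nonneg hs.le]
      field_simp
      norm_num
    rw [hf, hb, naturalForm_apply]
    simp only [slope, UpperHalfPlane.coe_im, mul_assoc]
  constructor
  · rintro h ⟨⟨z, α, s⟩, hα, hs⟩ v w
    obtain ⟨u, f, b, hu, hf, hb, hform⟩ := h ⟨α, hα⟩ ⟨s, hs⟩
    have hpos : (⟨α, hα⟩ : ℍ).im / (⟨s, hs⟩ : ℍ).im ≠ 0 :=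
      (div_pos (UpperHalfPlane.im_pos _) (UpperHalfPlane.im_pos _)).ne'
    rw [isRicciFlat_iff (UpperHalfPlane.im_pos _)] at hu
    subst hu
    rw [isHarmonicForm_const_iff hpos] at hf
    rw [isCanonicalLift_const_iff hpos] at hb
    subst hf hb
    exact (hform z v w).trans (hcoeff _ _ _ _ _)
  · intro h α s
    have hpos : α.im / s.im ≠ 0 := (div_pos α.im_pos s.im_pos).ne'
    exact ⟨_, _, _, (isRicciFlat_iff α.im_pos).2 rfl, (isHarmonicForm_const_iff hpos).2 rfl,
      (isCanonicalLift_const_iff hpos).2 rfl,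
      fun z v w => (h (Cover.mk z α s) v w).trans (hcoeff _ _ _ _ _).symm⟩

theorem isNaturalMetric_naturalMetric : IsNaturalMetric naturalMetric :=
  (isNaturalMetric_iff _).2 tangentForm_proj

theorem eq_naturalMetric {h : HermitianMetric (ℂ × ℂ × ℂ) FiberProduct} (hh : IsNaturalMetric h) :
    h = naturalMetric := by
  have hform : h.form = naturalMetric.form := by
    funext x
    obtain ⟨p, rfl⟩ : ∃ p, proj p = x := Quotient.mk_surjective x
    obtain ⟨n, m, -, h2⟩ := mfderiv_proj p
    refine ContinuousLinearMap.ext fun v => ContinuousLinearMap.ext fun w => ?_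
    obtain ⟨v', rfl⟩ := deckLinear_surjective m v
    obtain ⟨w', rfl⟩ := deckLinear_surjective m w
    rw [← h2, ← h2]
    exact ((isNaturalMetric_iff h).1 hh p v' w').trans (tangentForm_proj p v' w').symm
  cases h
  cases hform
  rfl

end FiberProduct

/-! ### The Kähler property -/

/-- The exterior derivative of a 1-form given as a field of linear functionals. -/
theorem extDeriv_ofSubsingletonLIE_apply {E : Type*} [NormedAddCommGroup E] [NormedSpace ℝ E]
    {η : E → E →L[ℝ] ℝ} {η' : E →L[ℝ] E →L[ℝ] ℝ} {x : E} (hη : HasFDerivAt η η' x)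
    (v : Fin 2 → E) :
    extDeriv (fun y => ContinuousAlternatingMap.ofSubsingletonLIE (0 : Fin 1) (η y)) x v =
      η' (v 0) (v 1) - η' (v 1) (v 0) := by
  have h : HasFDerivAt
      (fun y => ContinuousAlternatingMap.ofSubsingletonLIE (0 : Fin 1) (η y)) _ x :=
    (ContinuousAlternatingMap.ofSubsingletonLIE (𝕜 := ℝ) (E := E) (F := ℝ)
      (0 : Fin 1)).toContinuousLinearEquiv.hasFDerivAt.comp x hη
  rw [extDeriv, h.fderiv, ContinuousAlternatingMap.alternatizeUncurryFin_apply, Fin.sum_univ_two]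
  simp [Fin.removeNth, sub_eq_add_neg, show Fin.tail v 0 = v 1 from rfl]

namespace FiberProduct

/-- With `t = Im z / Im s`, the 1-form
`-t d(Re z) + (t² / 2 + 1 / (4 Im s)) d(Re s) + 1 / (4 Im α) d(Re α)`, as a field of linear
functionals. -/
def primitiveCovector (p : ℂ × ℂ × ℂ) : (ℂ × ℂ × ℂ) →L[ℝ] ℝ :=
  (-slope p) • Complex.reCLM.comp (ContinuousLinearMap.fst ℝ ℂ (ℂ × ℂ)) +
    (slope p ^ 2 / 2 + (p.2.2.im)⁻¹ / 4) • Complex.reCLM.comp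
      ((ContinuousLinearMap.snd ℝ ℂ ℂ).comp (ContinuousLinearMap.snd ℝ ℂ (ℂ × ℂ))) +
    ((p.2.1.im)⁻¹ / 4) • Complex.reCLM.comp
      ((ContinuousLinearMap.fst ℝ ℂ ℂ).comp (ContinuousLinearMap.snd ℝ ℂ (ℂ × ℂ)))

/-- A primitive, on the universal cover, of the fundamental form of the normalized metric. -/
def primitive (p : ℂ × ℂ × ℂ) : (ℂ × ℂ × ℂ) [⋀^Fin 1]→L[ℝ] ℝ :=
  ContinuousAlternatingMap.ofSubsingletonLIE (0 : Fin 1) (primitiveCovector p)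

theorem contDiffAt_primitive {n : WithTop ℕ∞} {p : ℂ × ℂ × ℂ} (hp : p ∈ Cover) :
    ContDiffAt ℝ n primitive p := by
  have h1 : ContDiff ℝ n fun p : ℂ × ℂ × ℂ => p.1.im := Complex.imCLM.contDiff.comp contDiff_fst
  have h2 : ContDiff ℝ n fun p : ℂ × ℂ × ℂ => p.2.1.im :=
    Complex.imCLM.contDiff.comp (contDiff_fst.comp contDiff_snd)
  have h3 : ContDiff ℝ n fun p : ℂ × ℂ × ℂ => p.2.2.im :=
    Complex.imCLM.contDiff.comp (contDiff_snd.comp contDiff_snd)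
  have hslope : ContDiffAt ℝ n slope p := h1.contDiffAt.div h3.contDiffAt hp.2.ne'
  refine (ContinuousAlternatingMap.ofSubsingletonLIE (𝕜 := ℝ) (E := ℂ × ℂ × ℂ) (F := ℝ)
    (0 : Fin 1)).contDiff.contDiffAt.comp p ?_
  exact ((hslope.neg.smul contDiffAt_const).add
    ((((hslope.pow 2).div_const 2).add ((h3.contDiffAt.inv hp.2.ne').div_const 4)).smul
      contDiffAt_const)).add (((h2.contDiffAt.inv hp.1.ne').div_const 4).smul contDiffAt_const)

/-- Writing `z = a + t s` with `a` and `t` real, the fundamental form of the normalized metric is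
`da ∧ dt + d(Re α) ∧ d(Im α) / (4 (Im α)²) + d(Re s) ∧ d(Im s) / (4 (Im s)²)`. -/
theorem extDeriv_primitive_apply {p : ℂ × ℂ × ℂ} (hp : p ∈ Cover) (v : Fin 2 → ℂ × ℂ × ℂ) :
    extDeriv primitive p v = -(((p.2.1.im)⁻¹ : ℝ) * naturalForm p (v 0) (v 1)).im := by
  have hα : p.2.1.im ≠ 0 := hp.1.ne'
  have hs : p.2.2.im ≠ 0 := hp.2.ne'
  have h1 : HasFDerivAt (fun p : ℂ × ℂ × ℂ => p.1.im)
      (Complex.imCLM.comp (ContinuousLinearMap.fst ℝ ℂ (ℂ × ℂ))) p :=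
    (Complex.imCLM.comp (ContinuousLinearMap.fst ℝ ℂ (ℂ × ℂ))).hasFDerivAt
  have h2 : HasFDerivAt (fun p : ℂ × ℂ × ℂ => (p.2.1.im)⁻¹) _ p :=
    (hasDerivAt_inv hα).comp_hasFDerivAt p (Complex.imCLM.comp ((ContinuousLinearMap.fst ℝ ℂ ℂ).comp
      (ContinuousLinearMap.snd ℝ ℂ (ℂ × ℂ)))).hasFDerivAt
  have h3 : HasFDerivAt (fun p : ℂ × ℂ × ℂ => (p.2.2.im)⁻¹) _ p :=
    (hasDerivAt_inv hs).comp_hasFDerivAt p (Complex.imCLM.comp ((ContinuousLinearMap.snd ℝ ℂ ℂ).comp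
      (ContinuousLinearMap.snd ℝ ℂ (ℂ × ℂ)))).hasFDerivAt
  have hslope : HasFDerivAt slope _ p := (h1.mul h3).congr_of_eventuallyEq
    (Filter.Eventually.of_forall fun q => div_eq_mul_inv _ _)
  have hη : HasFDerivAt primitiveCovector _ p :=
    ((hslope.neg.smul_const (Complex.reCLM.comp (ContinuousLinearMap.fst ℝ ℂ (ℂ × ℂ)))).add
      ((((hslope.pow 2).mul_const 2⁻¹).add (h3.mul_const 4⁻¹)).smul_const (Complex.reCLM.comp
        ((ContinuousLinearMap.snd ℝ ℂ ℂ).comp (ContinuousLinearMap.snd ℝ ℂ (ℂ × ℂ)))))).add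
      ((h2.mul_const 4⁻¹).smul_const (Complex.reCLM.comp
        ((ContinuousLinearMap.fst ℝ ℂ ℂ).comp (ContinuousLinearMap.snd ℝ ℂ (ℂ × ℂ)))))
  have h := extDeriv_ofSubsingletonLIE_apply hη v
  refine h.trans ?_
  rw [naturalForm_apply]
  generalize hc : p.2.1.im / (4 * p.2.2.im ^ 2) = c
  simp [slope]
  rw [← hc]
  field_simp
  ring

theorem extDeriv_extDeriv_primitive {p : ℂ × ℂ × ℂ} (hp : p ∈ Cover) :
    extDeriv (extDeriv primitive) p = 0 :=
  extDeriv_extDeriv_apply (r := 2) (contDiffAt_primitive hp) (by simp)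

theorem differentiableAt_extDeriv_primitive {p : ℂ × ℂ × ℂ} (hp : p ∈ Cover) :
    DifferentiableAt ℝ (extDeriv primitive) p :=
  (ContinuousAlternatingMap.alternatizeUncurryFinCLM ℝ (ℂ × ℂ × ℂ) ℝ).differentiableAt.comp p
    (((contDiffAt_primitive (n := 2) hp).fderiv_right (m := 1) (by norm_num)).differentiableAt
      one_ne_zero)

/-- The fundamental form of the normalized metric is closed on the whole fibre product, since it is
exact on the universal cover. -/
theorem extDeriv_pullbackForm_normalized {k : ℕ} {W : Set (Fin k → ℂ)}
    {φ : (Fin k → ℂ) → FiberProduct} (hW : IsOpen W)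
    (hφ : MDifferentiableOn 𝓘(ℂ, Fin k → ℂ) 𝓘(ℂ, ℂ × ℂ × ℂ) φ W) {y : Fin k → ℂ} (hy : y ∈ W) :
    extDeriv ((normalized naturalMetric).pullbackForm φ) y = 0 := by
  set e := chartAt (ℂ × ℂ × ℂ) (φ y) with he
  have hatlas : e ∈ atlas (ℂ × ℂ × ℂ) FiberProduct := chart_mem_atlas _ _
  set V := W ∩ φ ⁻¹' e.source with hV
  have hVo : IsOpen V := hφ.continuousOn.isOpen_inter_preimage hW e.open_source
  have hyV : y ∈ V := ⟨hy, mem_chart_source (ℂ × ℂ × ℂ) (φ y)⟩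
  let ψ : (Fin k → ℂ) → ℂ × ℂ × ℂ := fun x => e (φ x)
  have hφV (x) (hx : x ∈ V) : MDifferentiableAt 𝓘(ℂ, Fin k → ℂ) 𝓘(ℂ, ℂ × ℂ × ℂ) φ x :=
    (hφ x hx.1).mdifferentiableAt (hW.mem_nhds hx.1)
  have hψ : DifferentiableOn ℂ ψ V := fun x hx =>
    (mdifferentiableAt_iff_differentiableAt.1 ((mdifferentiableAt_atlas hatlas hx.2).comp x
      (hφV x hx))).differentiableWithinAt
  have hlift (x) (hx : x ∈ V) : ∃ hc : ψ x ∈ Cover, φ x = proj ⟨ψ x, hc⟩ := by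
    obtain ⟨hc, h⟩ := chart_symm hatlas (e.map_source hx.2)
    exact ⟨hc, (e.left_inv hx.2).symm.trans h⟩
  -- in the chart at `φ y` the map `φ` has the lift `ψ`, and there the form is a pullback along `ψ`
  have heq : (normalized naturalMetric).pullbackForm φ =ᶠ[𝓝 y] fun x =>
      (extDeriv primitive (ψ x)).compContinuousLinearMap (fderiv ℝ ψ x) := by
    filter_upwards [hVo.mem_nhds hyV] with x hx
    obtain ⟨hc, hx'⟩ := hlift x hx
    have hd : DifferentiableAt ℂ ψ x := hψ.differentiableAt (hVo.mem_nhds hx)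
    have hvol : vol (φ x) = (ψ x).2.1.im := by
      rw [hx']
      rfl
    ext v
    rw [ContinuousAlternatingMap.compContinuousLinearMap_apply, extDeriv_primitive_apply hc,
      hd.fderiv_restrictScalars ℝ, ← hvol]
    have h := tangentForm_eq_of_lift (hφV x hx) hd
      (Filter.eventually_of_mem (hVo.mem_nhds hx) hlift) (v 0) (v 1)
    exact congrArg (fun c : ℂ => -((((vol (φ x))⁻¹ : ℝ) : ℂ) * c).im) h
  have hC2 : ContDiffAt ℝ 2 ψ y :=
    ((contDiffOn_of_differentiableOn_complex hVo hψ 2).contDiffAt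
      (hVo.mem_nhds hyV)).restrict_scalars ℝ
  obtain ⟨hc, -⟩ := hlift y hyV
  rw [heq.extDeriv_eq, extDeriv_pullback (differentiableAt_extDeriv_primitive hc) hC2 (by simp),
    extDeriv_extDeriv_primitive hc]
  ext
  simp

end FiberProduct

end

theorem mainTheorem3 :
    (∃! h : HermitianMetric (ℂ × ℂ × ℂ) FiberProduct, IsNaturalMetric h) ∧
    ∀ h : HermitianMetric (ℂ × ℂ × ℂ) FiberProduct, IsNaturalMetric h →
      (∀ s : ℍ, (FiberProduct.normalized h).IsKahlerOnFiber FiberProduct.nu s) ∧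
      (∀ α : ℍ, (FiberProduct.normalized h).IsKahlerOnFiber FiberProduct.eta α) := by
  refine ⟨⟨FiberProduct.naturalMetric, FiberProduct.isNaturalMetric_naturalMetric,
    fun h hh => FiberProduct.eq_naturalMetric hh⟩, ?_⟩
  intro h hh
  obtain rfl := FiberProduct.eq_naturalMetric hh
  exact ⟨fun s k W φ hW hφ _ _ y hy =>
      FiberProduct.extDeriv_pullbackForm_normalized hW hφ hy,
    fun α k W φ hW hφ _ _ y hy =>
      FiberProduct.extDeriv_pullbackForm_normalized hW hφ hy⟩
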